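/- All graphs are finite, simple, loopless and undirected. For graphs $F, G$ let $\hom(F,G)$ be the number of homomorphisms $F \to G$. Graphs $G$ and $H$ are homomorphism indistinguishable over a class $\mathcal F$ of graphs if $\hom(F,G)=\hom(F,H)$ for all $F\in\mathcal F$. A graph has pathwidth at most $k$ if it has a path decomposition all of whose bags have at most $k+1$ vertices. A $(k+1,k+1)$-bilabelled graph $\boldsymbol B=(F,\vec u,\vec v)$ is a graph $F$ with tuples $\vec u,\vec v\in V(F)^{k+1}$. Its homomorphism matrix $\boldsymbol B_G\in\mathbb Q^{V(G)^{k+1}\times V(G)^{k+1}}$ has as $(\vec x,\vec y)$ entry the number of homomorphisms $h\colon F\to G$ with $h(\vec u_i)=\vec x_i$ and $h(\vec v_i)=\vec y_i$ for all $i$. The set $\mathcal B^k$ of $k$-basal graphs consists of the following bilabelled graphs, for $i\neq j$ in $[k+1]=\{1,\dots,k+1\}$: the identity graph $\boldsymbol I$ (vertex set $[k+1]$, no edges, $\vec u=\vec v=(1,\dots,k+1)$); the adjacency graph $\boldsymbol A^{ij}$ ($\boldsymbol I$ with the single edge $ij$ added); the identification graph $\boldsymbol I^{ij}$ (vertex set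 $[k+1]\setminus\{j\}$, no edges, $\vec u=\vec v=$ the tuple $(1,\dots,k+1)$ with its $j$-th entry replaced by $i$); and the forgetting graph $\boldsymbol F^{i}$ (vertex set $[k+1]\cup\{i'\}$ with $i'$ a new vertex, no edges, $\vec u=(1,\dots,k+1)$, $\vec v=$ the tuple $(1,\dots,k+1)$ with its $i$-th entry replaced by $i'$). The system $\mathsf{PW}^{k+1}(G,H)$ asks for a matrix $X$ indexed by $V(H)^{k+1}\times V(G)^{k+1}$ that is pseudo-stochastic (all row sums and all column sums are $1$) and satisfies $X\boldsymbol B_G=\boldsymbol B_HX$ for all $\boldsymbol B\in\mathcal B^k$. A set $\pi\subseteq V(H)\times V(G)$ is a partial isomorphism if for all $(w,v),(w',v')\in\pi$ one has $v=v'\iff w=w'$ and $vv'\in E(G)\iff ww'\in E(H)$. The system $\mathsf L^{k+1}_{\mathrm{iso}}(G,H)$ has a variable $X_\pi$ for every $\pi\subseteq V(H)\times V(G)$ with $|\pi|\le k+1$ and the equations $$\sum_{v\in V(G)}X_{\pi\cup\{(w,v)\}}=X_\pi\quad(|\pi|\le k,\ w\in V(H)),$$ $$\sum_{w\in V(H)}X_{\pi\cup\{(w,v)\}}=X_\pi\quad(|\pi|\le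 k,\ v\in V(G)),$$ $$X_\emptyset=1,\qquad X_\pi=0\quad(|\pi|\le k+1,\ \pi\text{ not a partial isomorphism}).$$ Theorem. For every integer $k\ge 1$ and all graphs $G$ and $H$, the following are equivalent: (1) $G$ and $H$ are homomorphism indistinguishable over the class of graphs of pathwidth at most $k$; (2) the system $\mathsf{PW}^{k+1}(G,H)$ has a rational solution; (3) the system $\mathsf L^{k+1}_{\mathrm{iso}}(G,H)$ has a rational solution. -/

import Mathlib

namespace HomTensor

/-! Finite simple graphs are Mathlib's `SimpleGraph`s on finite vertex types. -/

/-- `hom(F, G)`: the number of homomorphisms from `F` to `G`. -/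
noncomputable def homCount {U V : Type*} (F : SimpleGraph U) (G : SimpleGraph V) : ℕ :=
  Nat.card (F →g G)

/-- A decomposition of the graph `F` modelled on the graph `T`: a family of bags, indexed by the
vertices of `T`, that covers all vertices and all edges of `F` and such that the set of bags
containing a fixed vertex of `F` is connected in `T`. -/
structure Decomposition {U I : Type*} (F : SimpleGraph U) (T : SimpleGraph I) where
  bag : I → Finset U
  vertex_covered : ∀ u : U, ∃ t : I, u ∈ bag t
  edge_covered : ∀ u v : U, F.Adj u v → ∃ t : I, u ∈ bag t ∧ v ∈ bag t
  connected : ∀ u : U, (T.induce {t : I | u ∈ bag t}).Connected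

/-- `F` has pathwidth at most `k`: it has a decomposition modelled on a path (with at least one
vertex) all of whose bags have at most `k + 1` elements. -/
def PathwidthLE (k : ℕ) {U : Type*} (F : SimpleGraph U) : Prop :=
  ∃ (m : ℕ) (D : Decomposition F (SimpleGraph.pathGraph (m + 1))),
    ∀ t, (D.bag t).card ≤ k + 1

/-- `G` and `H` are homomorphism indistinguishable over the class `C` of finite graphs.
(Every finite graph is isomorphic to one whose vertex type lies in `Type`.) -/
def HomIndistinguishable (C : ∀ {U : Type}, SimpleGraph U → Prop) {V W : Type*}
    (G : SimpleGraph V) (H : SimpleGraph W) : Prop :=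
  ∀ (U : Type) [Finite U] (F : SimpleGraph U), C F → homCount F G = homCount F H

/-- An `(l₁, l₂)`-bilabelled graph `(F, u, v)`: a finite graph `F` with a tuple `u` of `l₁` in-labelled
vertices and a tuple `v` of `l₂` out-labelled vertices, not necessarily distinct. -/
structure BilabelledGraph (l₁ l₂ : ℕ) where
  vert : Type
  finite_vert : Finite vert
  graph : SimpleGraph vert
  inLabel : Fin l₁ → vert
  outLabel : Fin l₂ → vert

/-- The homomorphism matrix of a bilabelled graph `B = (F, u, v)` for a target graph `G`: its
`(x, y)` entry is the number of homomorphisms `h` from `F` to `G` with `h(u) = x` and `h(v) = y`. -/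
noncomputable def BilabelledGraph.homMatrix {l₁ l₂ : ℕ} (B : BilabelledGraph l₁ l₂)
    {V : Type*} (G : SimpleGraph V) : Matrix (Fin l₁ → V) (Fin l₂ → V) ℚ :=
  fun x y => (Nat.card {h : B.graph →g G //
    (∀ i, h (B.inLabel i) = x i) ∧ (∀ j, h (B.outLabel j) = y j)} : ℚ)

/-- The identity graph: `n` isolated vertices, the `i`-th carrying the `i`-th in- and out-label. -/
def identityGraph (n : ℕ) : BilabelledGraph n n where
  vert := Fin n
  finite_vert := inferInstance
  graph := ⊥
  inLabel := id
  outLabel := id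

/-- The adjacency graph `A^{ij}`: the identity graph with the single edge `ij` added. -/
def adjacencyGraph {n : ℕ} (i j : Fin n) : BilabelledGraph n n where
  vert := Fin n
  finite_vert := inferInstance
  graph := SimpleGraph.edge i j
  inLabel := id
  outLabel := id

/-- The identification graph `I^{ij}`, `i ≠ j`: the vertices are the elements of `[n]` other than
`j`, there are no edges, and the vertex `i` carries the `i`-th and the `j`-th in- and out-labels. -/
def identificationGraph {n : ℕ} (i j : Fin n) (hij : i ≠ j) : BilabelledGraph n n where
  vert := {a : Fin n // a ≠ j}
  finite_vert := inferInstance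
  graph := ⊥
  inLabel := fun a => if h : a = j then ⟨i, hij⟩ else ⟨a, h⟩
  outLabel := fun a => if h : a = j then ⟨i, hij⟩ else ⟨a, h⟩

/-- The forgetting graph `F^i`: the vertices are those of `[n]` (here `some a`) and one new vertex
`i'` (here `none`), there are no edges, and the `i`-th out-label lies on the new vertex. -/
def forgettingGraph {n : ℕ} (i : Fin n) : BilabelledGraph n n where
  vert := Option (Fin n)
  finite_vert := inferInstance
  graph := ⊥
  inLabel := fun a => some a
  outLabel := fun a => if a = i then none else some a

/-- The set of `k`-basal graphs, which are `(k+1, k+1)`-bilabelled. -/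
inductive IsBasal (k : ℕ) : BilabelledGraph (k + 1) (k + 1) → Prop
  | identity : IsBasal k (identityGraph (k + 1))
  | adjacency (i j : Fin (k + 1)) (hij : i ≠ j) : IsBasal k (adjacencyGraph i j)
  | identification (i j : Fin (k + 1)) (hij : i ≠ j) : IsBasal k (identificationGraph i j hij)
  | forgetting (i : Fin (k + 1)) : IsBasal k (forgettingGraph i)

/-- A matrix is pseudo-stochastic if all its row sums and all its column sums are `1`. -/
def PseudoStochastic {R C : Type*} [Fintype R] [Fintype C] (X : Matrix R C ℚ) : Prop :=
  (∀ r, ∑ c, X r c = 1) ∧ (∀ c, ∑ r, X r c = 1)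

/-- `X` is a rational solution of the system `PW^{k+1}(G, H)`. -/
def IsSolutionPW (k : ℕ) {V W : Type*} [Fintype V] [Fintype W]
    (G : SimpleGraph V) (H : SimpleGraph W)
    (X : Matrix (Fin (k + 1) → W) (Fin (k + 1) → V) ℚ) : Prop :=
  PseudoStochastic X ∧
    ∀ B : BilabelledGraph (k + 1) (k + 1), IsBasal k B → X * B.homMatrix G = B.homMatrix H * X

/-- `p ⊆ V(H) × V(G)` is a partial isomorphism. -/
def IsPartialIso {V W : Type*} (G : SimpleGraph V) (H : SimpleGraph W)
    (p : Finset (W × V)) : Prop :=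
  ∀ a ∈ p, ∀ b ∈ p, (a.2 = b.2 ↔ a.1 = b.1) ∧ (G.Adj a.2 b.2 ↔ H.Adj a.1 b.1)

/-- The subsets of `V(H) × V(G)` of size at most `n`. -/
abbrev SmallSet (W V : Type*) (n : ℕ) : Type _ := {p : Finset (W × V) // p.card ≤ n}

/-- For `p` of size at most `k`, the set `p ∪ {(w, v)}`, of size at most `k + 1`. -/
def SmallSet.extend {V W : Type*} [DecidableEq V] [DecidableEq W] {k : ℕ}
    (p : SmallSet W V k) (w : W) (v : V) : SmallSet W V (k + 1) :=
  ⟨insert (w, v) p.1, (Finset.card_insert_le _ _).trans (Nat.succ_le_succ p.2)⟩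

/-- For `p` of size at most `k`, the set `p` itself, of size at most `k + 1`. -/
def SmallSet.weaken {V W : Type*} {k : ℕ} (p : SmallSet W V k) : SmallSet W V (k + 1) :=
  ⟨p.1, p.2.trans (Nat.le_succ k)⟩

/-- `X` is a rational solution of the system `L_iso^{k+1}(G, H)`, whose variables are indexed by the
subsets of `V(H) × V(G)` of size at most `k + 1`. -/
structure IsSolutionLiso (k : ℕ) {V W : Type*} [Fintype V] [Fintype W]
    [DecidableEq V] [DecidableEq W] (G : SimpleGraph V) (H : SimpleGraph W)
    (X : SmallSet W V (k + 1) → ℚ) : Prop where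
  continuity_left : ∀ (p : SmallSet W V k) (w : W), ∑ v, X (p.extend w v) = X p.weaken
  continuity_right : ∀ (p : SmallSet W V k) (v : V), ∑ w, X (p.extend w v) = X p.weaken
  empty : X ⟨∅, Nat.zero_le _⟩ = 1
  compatible : ∀ p : SmallSet W V (k + 1), ¬ IsPartialIso G H p.1 → X p = 0

end HomTensor

/-! From (1) to (2): every basal graph acts as a symmetric 0-1 matrix. Applying a word of such
matrices to the all-ones vector gives a vector `wordVec`, and the sum of its entries counts
homomorphisms from a graph of pathwidth at most `k`, or is zero if the word forces a loop. By
symmetry the inner product of two such vectors is the entry sum for another word, so the families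
for `G` and `H` have equal Gram matrices. Over `ℚ` this yields a matrix `X` that carries one family
to the other and kills the orthogonal complement (`exists_matrix_of_gram_eq`); it intertwines the
basal matrices because both the span and its complement are invariant under them.

From (2) to (3): commuting with identification and adjacency graphs forces `X w v = 0` unless the
pairs `(w i, v i)` form a partial isomorphism. Commuting with forgetting graphs lets a sum over one
entry of `v` be traded for a sum over the same entry of `w`. Averaging over permutations of the
indices makes `X` a function of multisets of `k + 1` pairs. Smaller sets receive values by summing
out pairs `(w₀, v)` with `w₀` fixed; the exchange property gives the continuity equations.

From (3) to (1): sweep along a path decomposition of `F`. The numbers of partial homomorphisms into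
`G` and into `H`, as functions of the values on the current bag, are related by the linear map with
coefficients `Y` (`Transfers`). Introducing a vertex, forgetting a vertex and adding edges use the
two continuity equations and the compatibility equation respectively. At the empty final bag the
relation reads `hom(F, H) = Y ∅ * hom(F, G)`. -/

namespace HomTensor
open Matrix Finset

/-! ### Families of rational vectors with the same Gram matrix -/

section Gram

variable {ι R C : Type*} [Fintype C]

/-- Every rational vector is, up to a vector orthogonal to a given family, in its span. -/
theorem exists_mem_span_sub_orthogonal (z : ι → C → ℚ) (p : C → ℚ) :
    ∃ a ∈ Submodule.span ℚ (Set.range z), ∀ i, z i ⬝ᵥ (p - a) = 0 := by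
  classical
  let B : LinearMap.BilinForm ℚ (C → ℚ) := Matrix.toBilin' 1
  have hB : ∀ x y, B x y = x ⬝ᵥ y := fun x y => by
    simp [B, Matrix.toBilin'_apply']
  have hrefl : B.IsRefl := fun x y h => by rw [hB] at h ⊢; rwa [dotProduct_comm]
  have hc : IsCompl (Submodule.span ℚ (Set.range z))
      (B.orthogonal (Submodule.span ℚ (Set.range z))) := by
    rw [B.isCompl_orthogonal_iff_disjoint hrefl, Submodule.disjoint_def]
    intro x hx hx'
    have : B x x = 0 := hx' x hx
    rw [hB] at this
    -- The field is ordered, so the form is anisotropic and every subspace splits off.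
    exact dotProduct_self_eq_zero.1 this
  have hp : p ∈ Submodule.span ℚ (Set.range z) ⊔
      B.orthogonal (Submodule.span ℚ (Set.range z)) := by
    rw [hc.sup_eq_top]; trivial
  obtain ⟨a, ha, b, hb, rfl⟩ := Submodule.mem_sup.1 hp
  refine ⟨a, ha, fun i => ?_⟩
  rw [add_sub_cancel_left, ← hB]
  exact hb _ (Submodule.subset_span ⟨i, rfl⟩)

/-- Matrices agree if they agree on a family of vectors and on its orthogonal complement. -/
theorem matrix_ext_of_orthogonal (z : ι → C → ℚ) {M N : Matrix R C ℚ}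
    (h : ∀ i, M *ᵥ z i = N *ᵥ z i)
    (h' : ∀ p, (∀ i, z i ⬝ᵥ p = 0) → M *ᵥ p = N *ᵥ p) : M = N := by
  classical
  refine Matrix.toLin'.injective (LinearMap.ext fun p => ?_)
  obtain ⟨a, ha, hp⟩ := exists_mem_span_sub_orthogonal z p
  have h1 : Matrix.toLin' M a = Matrix.toLin' N a := by
    clear hp
    induction ha using Submodule.span_induction with
    | mem x hx => obtain ⟨i, rfl⟩ := hx; simpa using h i
    | zero => simp
    | add x y _ _ hx hy => rw [map_add, map_add, hx, hy]
    | smul c x _ hx => rw [map_smul, map_smul, hx]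
  have h2 : Matrix.toLin' M (p - a) = Matrix.toLin' N (p - a) := by
    simpa using h' _ hp
  rw [map_sub, map_sub, h1] at h2
  exact sub_left_injective h2

/-- Two families of rational vectors with the same Gram matrix are related by a matrix that
vanishes on the orthogonal complement of the first family. -/
theorem exists_matrix_of_gram_eq [Fintype R] (z : ι → C → ℚ) (z' : ι → R → ℚ)
    (h : ∀ i j, z i ⬝ᵥ z j = z' i ⬝ᵥ z' j) :
    ∃ M : Matrix R C ℚ, (∀ i, M *ᵥ z i = z' i) ∧ ∀ p, (∀ i, z i ⬝ᵥ p = 0) → M *ᵥ p = 0 := by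
  classical
  let φ := Finsupp.linearCombination ℚ z
  let φ' := Finsupp.linearCombination ℚ z'
  have hdot : ∀ c d, φ c ⬝ᵥ φ d = φ' c ⬝ᵥ φ' d := by
    intro c d
    simp only [φ, φ', Finsupp.linearCombination_apply, Finsupp.sum, sum_dotProduct,
      dotProduct_sum, smul_dotProduct, dotProduct_smul, h]
  have hker : LinearMap.ker φ ≤ LinearMap.ker φ' := by
    intro c hc
    rw [LinearMap.mem_ker] at hc ⊢
    have := hdot c c
    rw [hc, zero_dotProduct] at this
    exact dotProduct_self_eq_zero.1 this.symm
  choose a ha hp using exists_mem_span_sub_orthogonal z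
  have ha' : ∀ p, ∃ c, φ c = a p := fun p => by
    have := ha p
    rwa [← Finsupp.range_linearCombination] at this
  choose c hc using ha'
  -- The chosen coefficients `c p` of the projection of `p` are not unique. Any other `d` with `p -
  -- φ d` orthogonal to the family gives the same image, which makes `p ↦ φ' (c p)` linear.
  have key : ∀ p d, (∀ i, z i ⬝ᵥ (p - φ d) = 0) → φ' (c p) = φ' d := by
    intro p d hd
    have h0 : φ (c p - d) = 0 := by
      have h1 : ∀ i, z i ⬝ᵥ φ (c p - d) = 0 := by
        intro i
        have e1 := hp p i
        have e2 := hd i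
        rw [← hc, dotProduct_sub] at e1
        rw [dotProduct_sub] at e2
        rw [map_sub, dotProduct_sub]
        linarith
      have h2 : ∀ e, φ e ⬝ᵥ φ (c p - d) = 0 := by
        intro e
        generalize φ (c p - d) = y at h1
        simp [φ, Finsupp.linearCombination_apply, Finsupp.sum, sum_dotProduct, h1]
      exact dotProduct_self_eq_zero.1 (h2 _)
    have := hker h0
    rwa [LinearMap.mem_ker, map_sub, sub_eq_zero] at this
  have hcp : ∀ p i, z i ⬝ᵥ (p - φ (c p)) = 0 := fun p i => by rw [hc]; exact hp p i
  let f : (C → ℚ) →ₗ[ℚ] (R → ℚ) :=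
    { toFun := fun p => φ' (c p)
      map_add' := fun p q => by
        rw [← map_add]
        refine key _ _ fun i => ?_
        rw [map_add, add_sub_add_comm, dotProduct_add, hcp, hcp, add_zero]
      map_smul' := fun r p => by
        rw [RingHom.id_apply, ← map_smul]
        refine key _ _ fun i => ?_
        rw [map_smul, ← smul_sub, dotProduct_smul, hcp, smul_zero] }
  refine ⟨LinearMap.toMatrix' f, fun i => ?_, fun p hp' => ?_⟩
  · rw [LinearMap.toMatrix'_mulVec]
    refine (key (z i) (Finsupp.single i 1) fun j => ?_).trans ?_
    · simp [φ]
    · simp [φ']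
  · rw [LinearMap.toMatrix'_mulVec]
    refine (key p 0 fun j => ?_).trans ?_
    · simpa using hp' j
    · simp

end Gram

/-! ### From the system `L_iso` to homomorphism counts -/

/-! ### Partial sums over vertex maps -/

section Marginal

open Classical in
/-- The sum of `f` over all maps that agree with `h₀` outside `S`. -/
noncomputable def marg {U V : Type*} [Fintype U] [Fintype V] (S : Finset U) (f : (U → V) → ℚ)
    (h₀ : U → V) : ℚ :=
  ∑ h : U → V with ∀ u, u ∉ S → h u = h₀ u, f h

variable {U V : Type*} [Fintype U] [Fintype V]

theorem marg_empty (f : (U → V) → ℚ) (h₀ : U → V) : marg ∅ f h₀ = f h₀ := by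
  classical
  unfold marg
  rw [Finset.sum_eq_single h₀]
  · intro h hh hne
    exact absurd (funext fun u => (Finset.mem_filter.1 hh).2 u (by simp)) hne
  · simp

theorem marg_univ [DecidableEq U] (f : (U → V) → ℚ) (h₀ : U → V) : marg univ f h₀ = ∑ h, f h := by
  classical
  simp only [marg, mem_univ, not_true_eq_false, false_implies, implies_true, filter_true]
  congr!

theorem marg_congr {S : Finset U} {f f' : (U → V) → ℚ} {h₀ : U → V}
    (h : ∀ h, (∀ u, u ∉ S → h u = h₀ u) → f h = f' h) : marg S f h₀ = marg S f' h₀ := by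
  classical
  exact Finset.sum_congr rfl fun g hg => h g (Finset.mem_filter.1 hg).2

theorem marg_sum {ι : Type*} [Fintype ι] (S : Finset U) (f : ι → (U → V) → ℚ) (h₀ : U → V) :
    marg S (fun h => ∑ i, f i h) h₀ = ∑ i, marg S (f i) h₀ :=
  Finset.sum_comm

theorem marg_mul_right {S : Finset U} (f c : (U → V) → ℚ) (h₀ : U → V)
    (hc : ∀ h, (∀ u, u ∉ S → h u = h₀ u) → c h = c h₀) :
    marg S (fun h => f h * c h) h₀ = marg S f h₀ * c h₀ := by
  rw [marg_congr (f' := fun h => f h * c h₀) fun h hh => by rw [hc h hh]]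
  exact (Finset.sum_mul _ _ _).symm

theorem marg_insert [DecidableEq U] {S : Finset U} {u : U} (hu : u ∉ S) (f : (U → V) → ℚ)
    (h₀ : U → V) :
    marg (insert u S) f h₀ = ∑ v, marg S f (Function.update h₀ u v) := by
  classical
  unfold marg
  rw [← Finset.sum_fiberwise _ (fun h : U → V => h u)]
  refine Finset.sum_congr rfl fun v _ => Finset.sum_congr ?_ fun _ _ => rfl
  ext h
  simp only [mem_filter, mem_univ, true_and, mem_insert, not_or, Function.update_apply]
  constructor
  · rintro ⟨h1, rfl⟩ u' hu'
    split_ifs with e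
    · rw [e]
    · exact h1 u' ⟨e, hu'⟩
  · intro h1
    refine ⟨fun u' hu' => ?_, ?_⟩
    · simpa [hu'.1] using h1 u' hu'.2
    · simpa using h1 u hu

theorem marg_update [DecidableEq U] {S : Finset U} {u : U} (hu : u ∉ S) (f : (U → V) → ℚ)
    (h₀ : U → V) (v : V) :
    marg S f (Function.update h₀ u v) = marg S (fun h => f (Function.update h u v)) h₀ := by
  classical
  unfold marg
  refine Finset.sum_bij' (fun h _ => Function.update h u (h₀ u))
    (fun h _ => Function.update h u v) ?_ ?_ ?_ ?_ ?_
  · intro h hh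
    simp only [mem_filter, mem_univ, true_and] at hh ⊢
    intro u' hu'
    by_cases e : u' = u
    · subst e; simp
    · simpa [e] using hh u' hu'
  · intro h hh
    simp only [mem_filter, mem_univ, true_and] at hh ⊢
    intro u' hu'
    by_cases e : u' = u
    · subst e; simp
    · simpa [e] using hh u' hu'
  · intro h hh
    simp only [mem_filter, mem_univ, true_and] at hh
    have := hh u hu
    rw [Function.update_self] at this
    rw [Function.update_idem, ← this, Function.update_eq_self]
  · intro h hh
    simp only [mem_filter, mem_univ, true_and] at hh
    rw [Function.update_idem, ← hh u hu, Function.update_eq_self]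
  · intro h hh
    simp only [mem_filter, mem_univ, true_and] at hh
    have := hh u hu
    rw [Function.update_self] at this
    rw [Function.update_idem, ← this, Function.update_eq_self]

theorem marg_insert' [DecidableEq U] {S : Finset U} {u : U} (hu : u ∉ S) (f : (U → V) → ℚ)
    (h₀ : U → V) :
    marg (insert u S) f h₀ = marg S (fun h => ∑ v, f (Function.update h u v)) h₀ := by
  rw [marg_insert hu, marg_sum]
  exact Finset.sum_congr rfl fun v _ => marg_update hu f h₀ v

end Marginal

/-- A solution of the system `L_iso^n(G, H)`, extended to a function of all finite sets. -/
structure LocalSolution (n : ℕ) {V W : Type*} [Fintype V] [Fintype W] [DecidableEq V]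
    [DecidableEq W] (G : SimpleGraph V) (H : SimpleGraph W) (Y : Finset (W × V) → ℚ) : Prop where
  left : ∀ p, p.card < n → ∀ w, ∑ v, Y (insert (w, v) p) = Y p
  right : ∀ p, p.card < n → ∀ v, ∑ w, Y (insert (w, v) p) = Y p
  empty : Y ∅ = 1
  compatible : ∀ p, p.card ≤ n → ¬ IsPartialIso G H p → Y p = 0

theorem exists_localSolution_iff {k : ℕ} {V W : Type*} [Fintype V] [Fintype W] [DecidableEq V]
    [DecidableEq W] {G : SimpleGraph V} {H : SimpleGraph W} :
    (∃ X, IsSolutionLiso k G H X) ↔ ∃ Y, LocalSolution (k + 1) G H Y := by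
  constructor
  · rintro ⟨X, hX⟩
    -- The value on larger sets is arbitrary: the equations only involve sets of size at most `k +
    -- 1`.
    refine ⟨fun p => if hp : p.card ≤ k + 1 then X ⟨p, hp⟩ else 0, ?_, ?_, ?_, ?_⟩
    · intro p hp w
      have h1 : ∀ v, (insert (w, v) p).card ≤ k + 1 := fun v =>
        (Finset.card_insert_le _ _).trans hp
      simp only [h1, hp.le, dite_true]
      exact hX.continuity_left ⟨p, Nat.lt_succ_iff.1 hp⟩ w
    · intro p hp v
      have h1 : ∀ w, (insert (w, v) p).card ≤ k + 1 := fun w =>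
        (Finset.card_insert_le _ _).trans hp
      simp only [h1, hp.le, dite_true]
      exact hX.continuity_right ⟨p, Nat.lt_succ_iff.1 hp⟩ v
    · simpa using hX.empty
    · intro p hp hpi
      simp only [hp, dite_true]
      exact hX.compatible ⟨p, hp⟩ hpi
  · rintro ⟨Y, hY⟩
    exact ⟨fun p => Y p.1, fun p w => hY.left _ (Nat.lt_succ_iff.2 p.2) _,
      fun p v => hY.right _ (Nat.lt_succ_iff.2 p.2) _, hY.empty, fun p => hY.compatible _ p.2⟩

/-! ### Sweeping along a path decomposition -/

section Elimination

open Classical in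
/-- The indicator function of the maps that send all pairs in `T` to edges of `G`. -/
noncomputable def edgeIndicator {U V : Type*} (G : SimpleGraph V) (T : U → U → Prop) (h : U → V) :
    ℚ :=
  if ∀ a b, T a b → G.Adj (h a) (h b) then 1 else 0

theorem edgeIndicator_congr_adj {U V W : Type*} {G : SimpleGraph V} {H : SimpleGraph W}
    {T : U → U → Prop} {h : U → V} {g : U → W}
    (hh : ∀ a b, T a b → (G.Adj (h a) (h b) ↔ H.Adj (g a) (g b))) :
    edgeIndicator G T h = edgeIndicator H T g := by
  classical
  exact if_congr (forall₃_congr hh) rfl rfl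

theorem edgeIndicator_congr {U V : Type*} (G : SimpleGraph V) {T : U → U → Prop} {h h' : U → V}
    (hh : ∀ a b, T a b → h a = h' a ∧ h b = h' b) :
    edgeIndicator G T h = edgeIndicator G T h' :=
  edgeIndicator_congr_adj fun a b hab => by rw [(hh a b hab).1, (hh a b hab).2]

theorem edgeIndicator_sup {U V : Type*} (G : SimpleGraph V) (T E : U → U → Prop) :
    edgeIndicator G (T ⊔ E) = fun h => edgeIndicator G T h * edgeIndicator G E h := by
  classical
  funext h
  unfold edgeIndicator
  rw [ite_mul, one_mul, zero_mul, ← ite_and]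
  refine if_congr ?_ rfl rfl
  constructor
  · exact fun hh => ⟨fun a b hab => hh a b (Or.inl hab), fun a b hab => hh a b (Or.inr hab)⟩
  · rintro ⟨h1, h2⟩ a b (hab | hab)
    exacts [h1 a b hab, h2 a b hab]

theorem sum_edgeIndicator {U V : Type*} [Fintype U] [DecidableEq U] [Fintype V]
    (F : SimpleGraph U) (G : SimpleGraph V) :
    ∑ h, edgeIndicator G F.Adj h = homCount F G := by
  classical
  let e : (F →g G) ≃ {h : U → V // ∀ a b, F.Adj a b → G.Adj (h a) (h b)} :=
    { toFun := fun f => ⟨f, fun _ _ => f.map_rel⟩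
      invFun := fun h => ⟨h.1, fun {a b} => h.2 a b⟩
      left_inv := fun _ => rfl
      right_inv := fun _ => rfl }
  rw [homCount, Nat.card_congr e, Nat.card_eq_fintype_card, Fintype.card_subtype]
  exact (Finset.sum_congr rfl fun h _ => by unfold edgeIndicator; congr).trans
    (Finset.sum_boole _ _)

variable {U V W : Type*} [DecidableEq U] [DecidableEq V] [DecidableEq W] {n : ℕ}
  {G : SimpleGraph V} {H : SimpleGraph W}
  {Y : Finset (W × V) → ℚ}

theorem image_insert_update {S : Finset U} {u : U} (hu : u ∉ S) (g : U → W) (h : U → V) (w : W)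
    (v : V) :
    ((insert u S).image fun a => (Function.update g u w a, Function.update h u v a)) =
      insert (w, v) (S.image fun a => (g a, h a)) := by
  rw [Finset.image_insert, Function.update_self, Function.update_self]
  congr 1
  refine Finset.image_congr fun a ha => ?_
  have : a ≠ u := fun e => hu (e ▸ ha)
  simp [this]

variable [Fintype U] [Fintype V] [Fintype W]

/-- The numbers of maps satisfying the edge constraints `T`, as functions of the values on `S` with
the values on `D` summed out, are related by `Y`. -/
def Transfers (G : SimpleGraph V) (H : SimpleGraph W) (Y : Finset (W × V) → ℚ) (S D : Finset U)
    (T : U → U → Prop) : Prop :=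
  ∀ (g : U → W) (h₀ : U → V), marg D (edgeIndicator H T) g =
    marg S (fun h => Y (S.image fun u => (g u, h u)) * marg D (edgeIndicator G T) h) h₀

/-- No constraint involves `u` yet, so only the coefficient depends on the value of `h` at `u`;
summing it out is the equation `left` for the fixed vertex `g u`. -/
theorem Transfers.introduce (hY : LocalSolution n G H Y) {S D : Finset U} {T : U → U → Prop}
    (h : Transfers G H Y S D T) {u : U} (hS : u ∉ S) (hD : u ∉ D)
    (hT : ∀ a b, T a b → a ≠ u ∧ b ≠ u) (hn : S.card < n) : Transfers G H Y (insert u S) D T := by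
  intro g h₀
  rw [marg_insert' hS, h g h₀]
  refine marg_congr fun h _ => ?_
  have h1 : ∀ v, marg D (edgeIndicator G T) (Function.update h u v) =
      marg D (edgeIndicator G T) h := fun v => by
    rw [marg_update hD]
    refine marg_congr fun h' _ => edgeIndicator_congr G fun a b hab => ?_
    simp [hT a b hab]
  have h2 := fun v => image_insert_update hS g h (g u) v
  simp only [Function.update_eq_self] at h2
  simp only [h1, h2]
  rw [← Finset.sum_mul, hY.left _ (Finset.card_image_le.trans_lt hn)]

/-- Here the value `w` of `g` at `u` is summed out on the side of `H`; after swapping sums, `right`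
collapses the sum of coefficients over `w`. -/
theorem Transfers.forget (hY : LocalSolution n G H Y) {S D : Finset U} {T : U → U → Prop} {u : U}
    (h : Transfers G H Y (insert u S) D T) (hS : u ∉ S) (hD : u ∉ D) (hn : S.card < n) :
    Transfers G H Y S (insert u D) T := by
  intro g h₀
  rw [marg_insert hD]
  have h1 := fun w => h (Function.update g u w) h₀
  simp only [marg_insert' hS, image_insert_update hS] at h1
  simp only [h1, marg_insert hD]
  rw [← marg_sum]
  refine marg_congr fun h _ => ?_
  rw [Finset.sum_comm, Finset.mul_sum]
  refine Finset.sum_congr rfl fun v _ => ?_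
  rw [← Finset.sum_mul, hY.right _ (Finset.card_image_le.trans_lt hn)]

-- The new constraints only see `S`, so their indicator factors out of the sum over `D`. Where `Y`
-- is nonzero, the pairs form a partial isomorphism and the indicators for `G` and `H` coincide.
omit [DecidableEq U] in
theorem Transfers.addEdges (hY : LocalSolution n G H Y) {S D : Finset U} {T E : U → U → Prop}
    (h : Transfers G H Y S D T) (hSD : Disjoint S D) (hE : ∀ a b, E a b → a ∈ S ∧ b ∈ S)
    (hn : S.card ≤ n) : Transfers G H Y S D (T ⊔ E) := by
  have hE' : ∀ a b, E a b → a ∉ D ∧ b ∉ D := fun a b hab =>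
    ⟨Finset.disjoint_left.1 hSD (hE a b hab).1, Finset.disjoint_left.1 hSD (hE a b hab).2⟩
  intro g h₀
  simp only [edgeIndicator_sup]
  rw [marg_mul_right _ _ _ fun g' hg => edgeIndicator_congr H fun a b hab =>
    ⟨hg a (hE' a b hab).1, hg b (hE' a b hab).2⟩, h g h₀]
  conv_rhs =>
    enter [2, h]
    rw [marg_mul_right _ _ _ fun h' hh => edgeIndicator_congr G fun a b hab =>
      ⟨hh a (hE' a b hab).1, hh b (hE' a b hab).2⟩]
  rw [marg, marg, Finset.sum_mul]
  refine Finset.sum_congr rfl fun h _ => ?_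
  by_cases hp : IsPartialIso G H (S.image fun u => (g u, h u))
  · have : edgeIndicator H E g = edgeIndicator G E h := by
      refine edgeIndicator_congr_adj fun a b hab => ?_
      exact (hp _ (Finset.mem_image_of_mem _ (hE a b hab).1) _
        (Finset.mem_image_of_mem _ (hE a b hab).2)).2.symm
    rw [this, mul_assoc]
  · rw [hY.compatible _ (Finset.card_image_le.trans hn) hp]
    simp

theorem Transfers.introduce_union (hY : LocalSolution n G H Y) {S D : Finset U}
    {T : U → U → Prop} (h : Transfers G H Y S D T) (R : Finset U) (hS : Disjoint R S)
    (hD : Disjoint R D) (hT : ∀ a b, T a b → a ∉ R ∧ b ∉ R) (hn : (R ∪ S).card ≤ n) :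
    Transfers G H Y (R ∪ S) D T := by
  induction R using Finset.induction_on with
  | empty => simpa using h
  | insert u R hu ih =>
    rw [Finset.disjoint_insert_left] at hS hD
    rw [Finset.insert_union] at hn ⊢
    have hu' : u ∉ R ∪ S := by simp [hu, hS.1]
    rw [Finset.card_insert_of_notMem hu'] at hn
    simp only [Finset.mem_insert, not_or] at hT
    exact (ih hS.2 hD.2 (fun a b hab => ⟨(hT a b hab).1.2, (hT a b hab).2.2⟩)
      (by omega)).introduce hY hu' hD.1
      (fun a b hab => ⟨(hT a b hab).1.1, (hT a b hab).2.1⟩) (by omega)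

theorem Transfers.forget_union (hY : LocalSolution n G H Y) {S D R : Finset U}
    {T : U → U → Prop} (h : Transfers G H Y (R ∪ S) D T) (hS : Disjoint R S)
    (hD : Disjoint R D) (hn : (R ∪ S).card ≤ n) : Transfers G H Y S (R ∪ D) T := by
  induction R using Finset.induction_on generalizing D with
  | empty => simpa using h
  | insert u R hu ih =>
    rw [Finset.disjoint_insert_left] at hS hD
    rw [Finset.insert_union] at hn h
    have hu' : u ∉ R ∪ S := by simp [hu, hS.1]
    rw [Finset.card_insert_of_notMem hu'] at hn
    have := ih (h.forget hY hu' hD.1 (by omega)) hS.2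
      (Finset.disjoint_insert_right.2 ⟨hu, hD.2⟩) (by omega)
    rwa [Finset.union_insert, ← Finset.insert_union] at this

theorem LocalSolution.isEmpty_iff (hY : LocalSolution n G H Y) (hn : 0 < n) :
    IsEmpty V ↔ IsEmpty W := by
  constructor <;> intro _ <;> by_contra hne <;> rw [not_isEmpty_iff] at hne
  · simpa [hY.empty] using hY.left ∅ (by simpa) hne.some
  · simpa [hY.empty] using hY.right ∅ (by simpa) hne.some

open Classical in
theorem LocalSolution.homCount_eq (hY : LocalSolution n G H Y) (F : SimpleGraph U)
    (b : ℕ → Finset U) (M : ℕ) (h0 : b 0 = ∅) (hM : ∀ t, M ≤ t → b t = ∅)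
    (hv : ∀ u, ∃ t, u ∈ b t) (he : ∀ u v, F.Adj u v → ∃ t, u ∈ b t ∧ v ∈ b t)
    (hc : ∀ u s t r, s ≤ t → t ≤ r → u ∈ b s → u ∈ b r → u ∈ b t) (hn : ∀ t, (b t).card ≤ n) :
    homCount F G = homCount F H := by
  -- `D t` consists of the vertices already forgotten, and `T t` of the edges seen in some bag up to
  -- `t`.
  let D : ℕ → Finset U := fun t => {u | u ∉ b t ∧ ∃ s < t, u ∈ b s}
  let T : ℕ → U → U → Prop := fun t u v => F.Adj u v ∧ ∃ s ≤ t, u ∈ b s ∧ v ∈ b s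
  have hmD : ∀ t u, u ∈ D t ↔ u ∉ b t ∧ ∃ s < t, u ∈ b s := fun t u => by simp [D]
  have key : ∀ t, Transfers G H Y (b t) (D t) (T t) := by
    intro t
    induction t with
    | zero =>
      intro g h₀
      have hD0 : D 0 = ∅ := by ext u; simp [hmD]
      have hT0 : ∀ a c, ¬ T 0 a c := by
        rintro a c ⟨_, s, hs, h1, _⟩
        rw [Nat.le_zero.1 hs, h0] at h1
        simp at h1
      rw [h0, hD0, marg_empty, marg_empty]
      simp [marg_empty, hY.empty, edgeIndicator, hT0]
    | succ t ih =>
      have hD1 : D (t + 1) = (b t \ b (t + 1)) ∪ D t := by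
        ext u
        rw [Finset.mem_union, hmD, hmD, Finset.mem_sdiff]
        constructor
        · rintro ⟨h1, s, hs, h2⟩
          by_cases h3 : u ∈ b t
          · exact Or.inl ⟨h3, h1⟩
          · refine Or.inr ⟨h3, s, lt_of_le_of_ne (Nat.lt_succ_iff.1 hs) ?_, h2⟩
            rintro rfl; exact h3 h2
        · rintro (⟨h1, h2⟩ | ⟨h1, s, hs, h2⟩)
          · exact ⟨h2, t, Nat.lt_succ_self t, h1⟩
          · exact ⟨fun h3 => h1 (hc u s t (t + 1) hs.le t.le_succ h2 h3), s,
              hs.trans t.lt_succ_self, h2⟩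
      have hT1 : T (t + 1) = T t ⊔ fun u v => F.Adj u v ∧ u ∈ b (t + 1) ∧ v ∈ b (t + 1) := by
        funext u v
        refine propext ⟨?_, ?_⟩
        · rintro ⟨h1, s, hs, h2⟩
          rcases Nat.le_succ_iff.1 hs with h3 | rfl
          · exact Or.inl ⟨h1, s, h3, h2⟩
          · exact Or.inr ⟨h1, h2⟩
        · rintro (⟨h1, s, hs, h2⟩ | ⟨h1, h2⟩)
          · exact ⟨h1, s, hs.trans t.le_succ, h2⟩
          · exact ⟨h1, t + 1, le_rfl, h2⟩
      have e1 : b t = (b t \ b (t + 1)) ∪ (b t ∩ b (t + 1)) := by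
        exact (Finset.sdiff_union_inter _ _).symm
      have e2 : b (t + 1) = (b (t + 1) \ b t) ∪ (b t ∩ b (t + 1)) := by
        rw [Finset.inter_comm]; exact (Finset.sdiff_union_inter _ _).symm
      have hnew : ∀ u s, s ≤ t → u ∈ b s → u ∉ b (t + 1) \ b t := by
        intro u s hs h1 h2
        rw [Finset.mem_sdiff] at h2
        exact h2.2 (hc u s t (t + 1) hs t.le_succ h1 h2.1)
      rw [e1] at ih
      -- Forgetting precedes introducing, so every intermediate set lies in one of the two bags and
      -- has at most `n` elements.
      have s1 := ih.forget_union hY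
        (Finset.disjoint_left.2 fun u h1 h2 =>
          (Finset.mem_sdiff.1 h1).2 (Finset.mem_inter.1 h2).2)
        (Finset.disjoint_left.2 fun u h1 h2 => ((hmD t u).1 h2).1 (Finset.mem_sdiff.1 h1).1)
        (by rw [← e1]; exact hn t)
      rw [← hD1] at s1
      have s2 := s1.introduce_union hY (b (t + 1) \ b t)
        (Finset.disjoint_left.2 fun u h1 h2 =>
          (Finset.mem_sdiff.1 h1).2 (Finset.mem_inter.1 h2).1)
        (Finset.disjoint_left.2 fun u h1 h2 => ((hmD _ u).1 h2).1 (Finset.mem_sdiff.1 h1).1)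
        (fun u v ⟨_, s, hs, h1, h2⟩ => ⟨hnew u s hs h1, hnew v s hs h2⟩)
        (by rw [← e2]; exact hn _)
      rw [← e2] at s2
      rw [hT1]
      exact s2.addEdges hY (Finset.disjoint_left.2 fun u h1 h2 => ((hmD _ u).1 h2).1 h1)
        (fun _ _ h => h.2) (hn _)
  have hlt : ∀ t u, u ∈ b t → t < M := fun t u hu => by
    by_contra h
    rw [hM t (not_lt.1 h)] at hu
    simp at hu
  have hDM : D M = univ := by
    ext u
    obtain ⟨t, ht⟩ := hv u
    simp only [hmD, Finset.mem_univ, iff_true]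
    exact ⟨fun h => (hlt _ _ h).false, t, hlt _ _ ht, ht⟩
  have hTM : T M = F.Adj := by
    funext u v
    refine propext ⟨fun h => h.1, fun h => ?_⟩
    obtain ⟨t, ht⟩ := he u v h
    exact ⟨h, t, (hlt _ _ ht.1).le, ht⟩
  have hfin := key M
  rw [hM M le_rfl, hDM, hTM] at hfin
  -- `Transfers` speaks about base maps `g` and `h`, so the cases where no such maps exist are
  -- treated separately.
  have hmain : ∀ (g : U → W) (h : U → V), homCount F G = homCount F H := by
    intro g h
    have := hfin g h
    rw [marg_empty, marg_univ, marg_univ, sum_edgeIndicator, sum_edgeIndicator,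
      Finset.image_empty, hY.empty, one_mul] at this
    exact_mod_cast this.symm
  rcases isEmpty_or_nonempty U with hU | ⟨⟨u⟩⟩
  · exact hmain isEmptyElim isEmptyElim
  · obtain ⟨t, ht⟩ := hv u
    have hn0 : 0 < n := (Finset.card_pos.2 ⟨u, ht⟩).trans_le (hn t)
    rcases isEmpty_or_nonempty V with hV | ⟨⟨v⟩⟩
    · have := (hY.isEmpty_iff hn0).1 hV
      have h1 : IsEmpty (F →g G) := ⟨fun f => isEmptyElim (f u)⟩
      have h2 : IsEmpty (F →g H) := ⟨fun f => isEmptyElim (f u)⟩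
      simp [homCount]
    · rcases isEmpty_or_nonempty W with hW | ⟨⟨w⟩⟩
      · exact ((hY.isEmpty_iff hn0).2 hW).elim v
      · exact hmain (fun _ => w) fun _ => v

/-- The bags of a path decomposition that contain a given vertex form an interval. -/
theorem Decomposition.mem_bag_of_le {U : Type*} {F : SimpleGraph U} {m : ℕ}
    (D : Decomposition F (SimpleGraph.pathGraph (m + 1))) {u : U} {s t r : Fin (m + 1)}
    (hst : s ≤ t) (htr : t ≤ r) (hs : u ∈ D.bag s) (hr : u ∈ D.bag r) : u ∈ D.bag t := by
  by_contra ht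
  have hconn := (D.connected u).preconnected ⟨s, hs⟩ ⟨r, hr⟩
  rw [SimpleGraph.reachable_iff_reflTransGen] at hconn
  -- A walk from `s` among the bags containing `u` moves by one index at a time and must avoid `t`,
  -- so it never gets past `t`.
  have : r < t := by
    change (⟨r, hr⟩ : {t | u ∈ D.bag t}).1 < t
    generalize (⟨r, hr⟩ : {t | u ∈ D.bag t}) = r' at hconn
    induction hconn with
    | refl => exact lt_of_le_of_ne hst fun e => ht (e ▸ hs)
    | @tail a c _ hac ih =>
      have hadj := SimpleGraph.pathGraph_adj.1 (SimpleGraph.induce_adj.1 hac)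
      have hne : c.1 ≠ t := fun e => ht (e ▸ c.2)
      have hne' := Fin.val_ne_of_ne hne
      rw [Fin.lt_def] at ih ⊢
      omega
  exact absurd htr (not_le.2 this)

theorem LocalSolution.homIndistinguishable {k : ℕ} (hY : LocalSolution (k + 1) G H Y) :
    HomIndistinguishable (PathwidthLE k) G H := by
  classical
  rintro U hU F ⟨m, D, hD⟩
  have := Fintype.ofFinite U
  -- The bags are shifted by one, so that the sweep starts and ends with an empty bag.
  let b : ℕ → Finset U := fun t =>
    if h : 1 ≤ t ∧ t ≤ m + 1 then D.bag ⟨t - 1, by omega⟩ else ∅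
  have hb : ∀ t, b (t.val + 1) = D.bag t := fun t => by
    have : 1 ≤ t.val + 1 ∧ t.val + 1 ≤ m + 1 := by omega
    simp [b, this]
  refine hY.homCount_eq F b (m + 2) (by simp [b]) (fun t ht => ?_) (fun u => ?_)
    (fun u v huv => ?_) (fun u s t r hst htr hs hr => ?_) (fun t => ?_)
  · exact dif_neg (by omega)
  · obtain ⟨t, ht⟩ := D.vertex_covered u
    exact ⟨t + 1, by rwa [hb]⟩
  · obtain ⟨t, ht⟩ := D.edge_covered u v huv
    exact ⟨t + 1, by rwa [hb]⟩
  · have hmem : ∀ {t}, u ∈ b t → 1 ≤ t ∧ t ≤ m + 1 := fun {t} ht => by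
      by_contra h
      simp [b, h] at ht
    have h1 := hmem hs
    have h2 := hmem hr
    have h3 : 1 ≤ t ∧ t ≤ m + 1 := by omega
    simp only [b, h1, h2, h3, and_self, dite_true] at hs hr ⊢
    exact D.mem_bag_of_le (Fin.mk_le_mk.2 (by omega)) (Fin.mk_le_mk.2 (by omega)) hs hr
  · by_cases h : 1 ≤ t ∧ t ≤ m + 1
    · simp only [b, h, and_self, dite_true]
      exact hD _
    · simp [b, h]

end Elimination

/-! ### Words in basal graphs -/

/-- Constraints on a pair of `n`-tuples `x`, `y` of vertices of a graph: `x` and `y` agree on the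
indices in `keep`, and pairs of entries of `x` are equal or adjacent. -/
structure Layer (n : ℕ) where
  keep : Fin n → Prop
  eqs : Fin n → Fin n → Prop
  adjs : Fin n → Fin n → Prop

/-- The pair `(x, y)` satisfies the constraints `L`. -/
def Layer.Rel {n : ℕ} (L : Layer n) {V : Type*} (G : SimpleGraph V) (x y : Fin n → V) : Prop :=
  (∀ i, L.keep i → x i = y i) ∧ (∀ i j, L.eqs i j → x i = x j) ∧
    ∀ i j, L.adjs i j → G.Adj (x i) (x j)

open Classical in
/-- The `0`-`1` matrix of the relation defined by `L`. -/
noncomputable def Layer.mat {n : ℕ} (L : Layer n) {V : Type*} (G : SimpleGraph V) :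
    Matrix (Fin n → V) (Fin n → V) ℚ :=
  Matrix.of fun x y => if L.Rel G x y then 1 else 0

/-- The homomorphism matrix of `B` is the matrix of the symmetric relation defined by `L`. -/
def BilabelledGraph.IsGivenBy {n : ℕ} (B : BilabelledGraph n n) (L : Layer n) {V : Type*}
    (G : SimpleGraph V) : Prop :=
  B.homMatrix G = L.mat G ∧ ∀ x y, L.Rel G x y → L.Rel G y x

/-- When every vertex carries a label, a homomorphism is determined by `x` and `y`, so each entry is
0 or 1. -/
theorem BilabelledGraph.homMatrix_eq_mat {n : ℕ} {B : BilabelledGraph n n} {L : Layer n}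
    (hB : ∀ a, (∃ i, B.inLabel i = a) ∨ ∃ i, B.outLabel i = a) {V : Type*} {G : SimpleGraph V}
    (h : ∀ x y, (∃ h : B.graph →g G, (∀ i, h (B.inLabel i) = x i) ∧
      ∀ i, h (B.outLabel i) = y i) ↔ L.Rel G x y) : B.homMatrix G = L.mat G := by
  classical
  funext x y
  have hsub : Subsingleton {h : B.graph →g G //
      (∀ i, h (B.inLabel i) = x i) ∧ (∀ j, h (B.outLabel j) = y j)} := by
    refine ⟨fun f g => Subtype.ext (RelHom.ext fun a => ?_)⟩
    rcases hB a with ⟨i, rfl⟩ | ⟨i, rfl⟩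
    · rw [f.2.1, g.2.1]
    · rw [f.2.2, g.2.2]
  rw [Layer.mat, Matrix.of_apply]
  unfold BilabelledGraph.homMatrix
  split_ifs with hr
  · obtain ⟨f, hf⟩ := (h x y).2 hr
    have : Unique {h : B.graph →g G //
      (∀ i, h (B.inLabel i) = x i) ∧ (∀ j, h (B.outLabel j) = y j)} :=
      ⟨⟨⟨f, hf⟩⟩, fun _ => Subsingleton.elim _ _⟩
    rw [Nat.card_unique, Nat.cast_one]
  · have : IsEmpty {h : B.graph →g G //
      (∀ i, h (B.inLabel i) = x i) ∧ (∀ j, h (B.outLabel j) = y j)} :=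
      ⟨fun f => hr ((h x y).1 ⟨f.1, f.2⟩)⟩
    rw [Nat.card_of_isEmpty, Nat.cast_zero]

theorem Layer.rel_symm_of_keep {n : ℕ} {L : Layer n} (hL : ∀ i, L.keep i) {V : Type*}
    {G : SimpleGraph V} (x y : Fin n → V) (h : L.Rel G x y) : L.Rel G y x := by
  obtain rfl : x = y := funext fun i => h.1 i (hL i)
  exact h

theorem identityGraph_isGivenBy (n : ℕ) {V : Type*} (G : SimpleGraph V) :
    (identityGraph n).IsGivenBy ⟨fun _ => True, fun _ _ => False, fun _ _ => False⟩ G := by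
  refine ⟨BilabelledGraph.homMatrix_eq_mat (fun a => Or.inl ⟨a, rfl⟩) fun x y => ⟨?_, ?_⟩,
    Layer.rel_symm_of_keep fun _ => trivial⟩
  · rintro ⟨h, h1, h2⟩
    exact ⟨fun i _ => (h1 i).symm.trans (h2 i), fun _ _ h => h.elim, fun _ _ h => h.elim⟩
  · rintro ⟨h, -⟩
    exact ⟨⟨x, fun h => h.elim⟩, fun i => rfl, fun i => h i trivial⟩

theorem adjacencyGraph_isGivenBy {n : ℕ} {i j : Fin n} (hij : i ≠ j) {V : Type*}
    (G : SimpleGraph V) :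
    (adjacencyGraph i j).IsGivenBy
      ⟨fun _ => True, fun _ _ => False, fun a b => a = i ∧ b = j⟩ G := by
  refine ⟨BilabelledGraph.homMatrix_eq_mat (fun a => Or.inl ⟨a, rfl⟩) fun x y => ⟨?_, ?_⟩,
    Layer.rel_symm_of_keep fun _ => trivial⟩
  · rintro ⟨h, h1, h2⟩
    refine ⟨fun i _ => (h1 i).symm.trans (h2 i), fun _ _ h => h.elim, ?_⟩
    rintro _ _ ⟨rfl, rfl⟩
    rw [← h1, ← h1]
    exact h.map_rel ((SimpleGraph.edge_adj _ _ _ _).2 ⟨Or.inl ⟨rfl, rfl⟩, hij⟩)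
  · rintro ⟨h, -, h'⟩
    have hx : ∀ a b, (SimpleGraph.edge i j).Adj a b → G.Adj (x a) (x b) := by
      intro a b hab
      rcases ((SimpleGraph.edge_adj _ _ _ _).1 hab).1 with ⟨rfl, rfl⟩ | ⟨rfl, rfl⟩
      · exact h' _ _ ⟨rfl, rfl⟩
      · exact (h' _ _ ⟨rfl, rfl⟩).symm
    exact ⟨⟨x, fun {a b} => hx a b⟩, fun i => rfl, fun i => h i trivial⟩

theorem identificationGraph_isGivenBy {n : ℕ} {i j : Fin n} (hij : i ≠ j) {V : Type*}
    (G : SimpleGraph V) :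
    (identificationGraph i j hij).IsGivenBy
      ⟨fun _ => True, fun a b => a = i ∧ b = j, fun _ _ => False⟩ G := by
  have hl : ∀ a : {a : Fin n // a ≠ j}, (identificationGraph i j hij).inLabel a.1 = a := fun a =>
    dif_neg a.2
  have hj : (identificationGraph i j hij).inLabel j = (⟨i, hij⟩ : {a : Fin n // a ≠ j}) :=
    dif_pos rfl
  refine ⟨BilabelledGraph.homMatrix_eq_mat (fun a => Or.inl ⟨_, hl a⟩) fun x y => ⟨?_, ?_⟩,
    Layer.rel_symm_of_keep fun _ => trivial⟩
  · rintro ⟨h, h1, h2⟩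
    refine ⟨fun i _ => (h1 i).symm.trans (h2 i), ?_, fun _ _ h => h.elim⟩
    rintro _ _ ⟨rfl, rfl⟩
    rw [← h1, ← h1, hj]
    exact congrArg h (hl ⟨_, hij⟩)
  · rintro ⟨h, h', -⟩
    have hx : ∀ a, x ((identificationGraph i j hij).inLabel a : {a : Fin n // a ≠ j}).1 = x a := by
      intro a
      by_cases ha : a = j
      · subst ha; rw [hj]; exact h' _ _ ⟨rfl, rfl⟩
      · exact congrArg (fun b : {a : Fin n // a ≠ j} => x b.1) (hl ⟨a, ha⟩)
    exact ⟨⟨fun a : {a : Fin n // a ≠ j} => x a.1, fun h => h.elim⟩, hx,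
      fun a => (hx a).trans (h a trivial)⟩

theorem forgettingGraph_isGivenBy {n : ℕ} (i : Fin n) {V : Type*} (G : SimpleGraph V) :
    (forgettingGraph i).IsGivenBy
      ⟨fun a => a ≠ i, fun _ _ => False, fun _ _ => False⟩ G := by
  refine ⟨BilabelledGraph.homMatrix_eq_mat (fun a => ?_) fun x y => ⟨?_, ?_⟩, ?_⟩
  · cases a with
    | none => exact Or.inr ⟨i, if_pos rfl⟩
    | some a => exact Or.inl ⟨a, rfl⟩
  · rintro ⟨h, h1, h2⟩
    refine ⟨fun a ha => ?_, fun _ _ h => h.elim, fun _ _ h => h.elim⟩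
    rw [← h1, ← h2]
    exact congrArg h (if_neg ha).symm
  · rintro ⟨h, -⟩
    refine ⟨⟨fun a : Option (Fin n) => a.elim (y i) x, fun h => h.elim⟩, fun _ => rfl, fun a => ?_⟩
    change Option.elim (if a = i then none else some a) (y i) x = y a
    split_ifs with ha
    · rw [ha]; rfl
    · exact h a ha
  · rintro x y ⟨h, -⟩
    exact ⟨fun a ha => (h a ha).symm, fun _ _ h => h.elim, fun _ _ h => h.elim⟩

theorem IsBasal.exists_layer {k : ℕ} {B : BilabelledGraph (k + 1) (k + 1)} (hB : IsBasal k B)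
    {V W : Type*} (G : SimpleGraph V) (H : SimpleGraph W) :
    ∃ L : Layer (k + 1), B.IsGivenBy L G ∧ B.IsGivenBy L H := by
  cases hB with
  | identity => exact ⟨_, identityGraph_isGivenBy _ G, identityGraph_isGivenBy _ H⟩
  | adjacency i j hij => exact ⟨_, adjacencyGraph_isGivenBy hij G, adjacencyGraph_isGivenBy hij H⟩
  | identification i j hij =>
    exact ⟨_, identificationGraph_isGivenBy hij G, identificationGraph_isGivenBy hij H⟩
  | forgetting i => exact ⟨_, forgettingGraph_isGivenBy i G, forgettingGraph_isGivenBy i H⟩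

/-! ### Words as graphs of bounded pathwidth, and the matrix `X` -/

section Word

variable {n : ℕ}

/-- The product of the matrices of a word, applied to the all-ones vector. -/
noncomputable def wordVec {V : Type*} [Fintype V] (G : SimpleGraph V) :
    List (Layer n) → (Fin n → V) → ℚ
  | [] => 1
  | L :: w => L.mat G *ᵥ wordVec G w

/-- The maps that satisfy the constraints of all layers of a word. -/
def WordHom {V : Type*} (G : SimpleGraph V) (w : List (Layer n))
    (h : Fin (w.length + 1) → Fin n → V) : Prop :=
  ∀ t : Fin w.length, (w.get t).Rel G (h t.castSucc) (h t.succ)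

open Classical in
theorem wordVec_eq_sum {V : Type*} [Fintype V] (G : SimpleGraph V) (w : List (Layer n))
    (x : Fin n → V) :
    wordVec G w x = ∑ h : Fin (w.length + 1) → Fin n → V,
      if h 0 = x ∧ WordHom G w h then 1 else 0 := by
  induction w generalizing x with
  | nil =>
    refine Eq.trans ?_ ((Equiv.funUnique (Fin 1) (Fin n → V)).symm.sum_comp _)
    simp [wordVec, WordHom]
  | cons L w ih =>
    refine Eq.trans ?_ ((Fin.consEquiv fun _ : Fin (w.length + 2) => Fin n → V).sum_comp _)
    rw [wordVec, Matrix.mulVec, dotProduct, Fintype.sum_prod_type]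
    refine Eq.trans ?_ (Finset.sum_eq_single x (fun y _ hy =>
      Finset.sum_eq_zero fun h _ => if_neg fun hh => hy hh.1) (by simp)).symm
    simp only [ih, Layer.mat, Matrix.of_apply, Finset.mul_sum]
    rw [Finset.sum_comm]
    refine Finset.sum_congr rfl fun h _ => ?_
    rw [Finset.sum_eq_single (h 0)]
    · rw [ite_mul, one_mul, zero_mul, ← ite_and]
      refine if_congr ⟨?_, ?_⟩ rfl rfl
      · rintro ⟨h1, -, h2⟩
        refine ⟨rfl, fun (t : Fin (w.length + 1)) => ?_⟩
        induction t using Fin.cases with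
        | zero => exact h1
        | succ t => exact h2 t
      · rintro ⟨-, h1⟩
        exact ⟨h1 (0 : Fin (w.length + 1)), rfl, fun t => h1 t.succ⟩
    · intro y _ hy
      have : ¬ (h 0 = y ∧ WordHom G w h) := fun h' => hy h'.1.symm
      rw [if_neg this, mul_zero]
    · simp

theorem sum_wordVec {V : Type*} [Fintype V] (G : SimpleGraph V) (w : List (Layer n)) :
    ∑ x, wordVec G w x = Nat.card {h : Fin (w.length + 1) → Fin n → V // WordHom G w h} := by
  classical
  simp only [wordVec_eq_sum]
  rw [Finset.sum_comm, Nat.card_eq_fintype_card, Fintype.card_subtype, ← Finset.sum_boole]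
  refine Finset.sum_congr rfl fun h _ => ?_
  simp [ite_and]

/-- The vertices that have to be identified in order to realize a word as a graph. -/
inductive WordLink (w : List (Layer n)) :
    Fin (w.length + 1) × Fin n → Fin (w.length + 1) × Fin n → Prop
  | keep (t : Fin w.length) (i : Fin n) : (w.get t).keep i → WordLink w (t.castSucc, i) (t.succ, i)
  | eqs (t : Fin w.length) (i j : Fin n) :
    (w.get t).eqs i j → WordLink w (t.castSucc, i) (t.castSucc, j)

/-- The pairs of vertices that have to be joined by an edge in order to realize a word as a
graph. -/
inductive WordEdge (w : List (Layer n)) :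
    Fin (w.length + 1) × Fin n → Fin (w.length + 1) × Fin n → Prop
  | adjs (t : Fin w.length) (i j : Fin n) :
    (w.get t).adjs i j → WordEdge w (t.castSucc, i) (t.castSucc, j)

theorem wordHom_iff {V : Type*} (G : SimpleGraph V) (w : List (Layer n))
    (h : Fin (w.length + 1) → Fin n → V) :
    WordHom G w h ↔ (∀ p q, WordLink w p q → h p.1 p.2 = h q.1 q.2) ∧
      ∀ p q, WordEdge w p q → G.Adj (h p.1 p.2) (h q.1 q.2) := by
  constructor
  · intro hh
    refine ⟨?_, ?_⟩
    · rintro _ _ (⟨t, i, hi⟩ | ⟨t, i, j, hij⟩)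
      exacts [(hh t).1 i hi, (hh t).2.1 i j hij]
    · rintro _ _ ⟨t, i, j, hij⟩
      exact (hh t).2.2 i j hij
  · rintro ⟨h1, h2⟩ t
    exact ⟨fun i hi => h1 _ _ (.keep t i hi), fun i j hij => h1 _ _ (.eqs t i j hij),
      fun i j hij => h2 _ _ (.adjs t i j hij)⟩

/-- The vertices of the graph of a word. -/
abbrev WordVertex (w : List (Layer n)) : Type := Quot (WordLink w)

/-- The graph of a word, up to loops. -/
def wordGraph (w : List (Layer n)) : SimpleGraph (WordVertex w) :=
  SimpleGraph.fromRel fun a b => ∃ p q, WordEdge w p q ∧ Quot.mk _ p = a ∧ Quot.mk _ q = b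

theorem card_wordHom_of_loop {w : List (Layer n)} {p q : Fin (w.length + 1) × Fin n}
    (he : WordEdge w p q) (hpq : Quot.mk (WordLink w) p = Quot.mk _ q) {V : Type*}
    (G : SimpleGraph V) : Nat.card {h : Fin (w.length + 1) → Fin n → V // WordHom G w h} = 0 := by
  have : IsEmpty {h : Fin (w.length + 1) → Fin n → V // WordHom G w h} := by
    refine ⟨fun ⟨h, hh⟩ => ?_⟩
    rw [wordHom_iff] at hh
    have := congrArg (Quot.lift (fun p => h p.1 p.2) hh.1) hpq
    exact (hh.2 p q he).ne this
  exact Nat.card_of_isEmpty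

theorem card_wordHom_of_loopless {w : List (Layer n)}
    (hw : ∀ p q, WordEdge w p q → Quot.mk (WordLink w) p ≠ Quot.mk _ q) {V : Type*}
    (G : SimpleGraph V) :
    Nat.card {h : Fin (w.length + 1) → Fin n → V // WordHom G w h} = homCount (wordGraph w) G := by
  refine Nat.card_congr
    { toFun := fun h => ⟨Quot.lift (fun p => h.1 p.1 p.2) ((wordHom_iff G w h.1).1 h.2).1, ?_⟩
      invFun := fun f => ⟨fun t i => f (Quot.mk _ (t, i)), ?_⟩
      left_inv := fun h => rfl
      right_inv := fun f => ?_ }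
  · rintro a b hab
    obtain ⟨-, ⟨p, q, he, rfl, rfl⟩ | ⟨p, q, he, rfl, rfl⟩⟩ := (SimpleGraph.fromRel_adj _ _ _).1 hab
    · exact ((wordHom_iff G w h.1).1 h.2).2 p q he
    · exact (((wordHom_iff G w h.1).1 h.2).2 p q he).symm
  · rw [wordHom_iff]
    refine ⟨fun p q hpq => congrArg f (Quot.sound hpq), fun p q hpq => f.map_rel ?_⟩
    exact (SimpleGraph.fromRel_adj _ _ _).2 ⟨hw p q hpq, Or.inl ⟨p, q, hpq, rfl, rfl⟩⟩
  · refine RelHom.ext fun a => ?_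
    induction a using Quot.ind
    rfl

-- The bags are the images of the columns `{t} × Fin (k + 1)`. Edges join positions in one column,
-- and a link stays in its column or moves to the next, so the columns meeting a given class are
-- connected.
open Classical in
theorem wordGraph_pathwidthLE {k : ℕ} (w : List (Layer (k + 1))) :
    PathwidthLE k (wordGraph w) := by
  refine ⟨w.length, ⟨fun t => univ.image fun i => Quot.mk _ (t, i), ?_, ?_, ?_⟩, fun t => ?_⟩
  · intro a
    induction a using Quot.ind with
    | mk p => exact ⟨p.1, Finset.mem_image_of_mem (fun i => Quot.mk _ (p.1, i)) (mem_univ p.2)⟩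
  · intro a b hab
    obtain ⟨-, ⟨p, q, ⟨t, i, j, he⟩, rfl, rfl⟩ | ⟨p, q, ⟨t, i, j, he⟩, rfl, rfl⟩⟩ :=
      (SimpleGraph.fromRel_adj _ _ _).1 hab
    · exact ⟨t.castSucc, mem_image_of_mem _ (mem_univ _), mem_image_of_mem _ (mem_univ _)⟩
    · exact ⟨t.castSucc, mem_image_of_mem _ (mem_univ _), mem_image_of_mem _ (mem_univ _)⟩
  · intro a
    have hmem : ∀ p : Fin (w.length + 1) × Fin (k + 1), Quot.mk (WordLink w) p = a →
        p.1 ∈ {t | a ∈ univ.image fun i => Quot.mk (WordLink w) (t, i)} := by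
      rintro p rfl
      exact mem_image_of_mem (fun i => Quot.mk _ (p.1, i)) (mem_univ p.2)
    have key : ∀ p q, Relation.EqvGen (WordLink w) p q → ∀ (hp : Quot.mk _ p = a)
        (hq : Quot.mk _ q = a), ((SimpleGraph.pathGraph (w.length + 1)).induce
          {t | a ∈ univ.image fun i => Quot.mk (WordLink w) (t, i)}).Reachable
          ⟨p.1, hmem p hp⟩ ⟨q.1, hmem q hq⟩ := by
      intro p q hpq
      induction hpq with
      | rel p q h =>
        intro hp hq
        cases h with
        | keep t i h =>
          refine SimpleGraph.Adj.reachable ?_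
          rw [SimpleGraph.induce_adj, SimpleGraph.pathGraph_adj]
          left; simp
        | eqs t i j h => exact SimpleGraph.Reachable.refl _
      | refl p => intro _ _; exact SimpleGraph.Reachable.refl _
      | symm p q _ ih => intro hp hq; exact (ih hq hp).symm
      | trans p q r h1 _ ih1 ih2 =>
        intro hp hr
        have hq : Quot.mk _ q = a := (Quot.eqvGen_sound h1).symm.trans hp
        exact (ih1 hp hq).trans (ih2 hq hr)
    have : Nonempty {t | a ∈ univ.image fun i => Quot.mk (WordLink w) (t, i)} := by
      induction a using Quot.ind with
      | mk p => exact ⟨p.1, hmem p rfl⟩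
    refine ⟨?_⟩
    rintro ⟨s, hs⟩ ⟨t, ht⟩
    obtain ⟨i, -, hi⟩ := mem_image.1 (Set.mem_ofPred_eq ▸ hs)
    obtain ⟨j, -, hj⟩ := mem_image.1 (Set.mem_ofPred_eq ▸ ht)
    exact key (s, i) (t, j) (Quot.eqvGen_exact (hi.trans hj.symm)) hi hj
  · exact card_image_le.trans (by simp)

theorem HomIndistinguishable.sum_wordVec_eq {k : ℕ} {V W : Type*} [Fintype V] [Fintype W]
    {G : SimpleGraph V} {H : SimpleGraph W} (h : HomIndistinguishable (PathwidthLE k) G H)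
    (w : List (Layer (k + 1))) : ∑ x, wordVec G w x = ∑ x, wordVec H w x := by
  rw [sum_wordVec, sum_wordVec]
  by_cases hw : ∀ p q, WordEdge w p q → Quot.mk (WordLink w) p ≠ Quot.mk _ q
  · have : Finite (WordVertex w) := Quot.finite _
    rw [card_wordHom_of_loopless hw, card_wordHom_of_loopless hw,
      h _ (wordGraph w) (wordGraph_pathwidthLE w)]
  · push Not at hw
    obtain ⟨p, q, he, hpq⟩ := hw
    rw [card_wordHom_of_loop he hpq, card_wordHom_of_loop he hpq]

theorem Layer.mat_transpose {V : Type*} {G : SimpleGraph V} {L : Layer n}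
    (hL : ∀ x y, L.Rel G x y → L.Rel G y x) : (L.mat G)ᵀ = L.mat G := by
  classical
  funext x y
  exact if_congr ⟨hL _ _, hL _ _⟩ rfl rfl

theorem dotProduct_mulVec_of_symm {R : Type*} [Fintype R] {M : Matrix R R ℚ} (hM : Mᵀ = M)
    (x y : R → ℚ) : (M *ᵥ x) ⬝ᵥ y = x ⬝ᵥ (M *ᵥ y) := by
  conv_lhs => rw [← hM, mulVec_transpose, ← dotProduct_mulVec]

/-- Symmetric matrices can be moved across the inner product one at a time, which reverses their
order. -/
theorem wordVec_dotProduct {V : Type*} [Fintype V] {G : SimpleGraph V} {w w' : List (Layer n)}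
    (hw : ∀ L ∈ w, (L.mat G)ᵀ = L.mat G) :
    wordVec G w ⬝ᵥ wordVec G w' = ∑ x, wordVec G (w.reverse ++ w') x := by
  induction w generalizing w' with
  | nil => simp [wordVec, dotProduct]
  | cons L w ih =>
    rw [wordVec, dotProduct_mulVec_of_symm (hw L (by simp)), ← wordVec,
      ih fun L' h => hw L' (List.mem_cons_of_mem _ h)]
    simp

theorem HomIndistinguishable.exists_isSolutionPW {k : ℕ} {V W : Type*} [Fintype V] [Fintype W]
    {G : SimpleGraph V} {H : SimpleGraph W} (h : HomIndistinguishable (PathwidthLE k) G H) :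
    ∃ X, IsSolutionPW k G H X := by
  classical
  choose L hL using fun B : {B // IsBasal k B} => B.2.exists_layer G H
  have hsG : ∀ B, ((L B).mat G)ᵀ = (L B).mat G := fun B => Layer.mat_transpose (hL B).1.2
  have hsH : ∀ B, ((L B).mat H)ᵀ = (L B).mat H := fun B => Layer.mat_transpose (hL B).2.2
  let z : List {B // IsBasal k B} → (Fin (k + 1) → V) → ℚ := fun w => wordVec G (w.map L)
  let z' : List {B // IsBasal k B} → (Fin (k + 1) → W) → ℚ := fun w => wordVec H (w.map L)
  have hgram : ∀ w w', z w ⬝ᵥ z w' = z' w ⬝ᵥ z' w' := by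
    intro w w'
    rw [wordVec_dotProduct, wordVec_dotProduct, h.sum_wordVec_eq]
    · intro _ hL'
      obtain ⟨B, -, rfl⟩ := List.mem_map.1 hL'
      exact hsH B
    · intro _ hL'
      obtain ⟨B, -, rfl⟩ := List.mem_map.1 hL'
      exact hsG B
  obtain ⟨X, hX, hX0⟩ := exists_matrix_of_gram_eq z z' hgram
  have hcol : replicateRow Unit (1 : (Fin (k + 1) → W) → ℚ) * X =
      replicateRow Unit (1 : (Fin (k + 1) → V) → ℚ) := by
    -- The all-ones vectors are the members of the families for the empty word. Hence column sums
    -- come from the Gram identity on the span and from orthogonality on the complement.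
    refine matrix_ext_of_orthogonal z (fun w => ?_) fun p hp => ?_
    · rw [← mulVec_mulVec, hX]
      funext u
      exact (hgram [] w).symm
    · rw [← mulVec_mulVec, hX0 p hp, mulVec_zero]
      funext u
      exact (hp []).symm
  refine ⟨X, ⟨fun r => ?_, fun c => ?_⟩, fun B hB => ?_⟩
  · simpa [z, z', wordVec, mulVec, dotProduct] using congrFun (hX []) r
  · simpa [Matrix.mul_apply] using congrFun (congrFun hcol ()) c
  · rw [(hL ⟨B, hB⟩).1.1, (hL ⟨B, hB⟩).2.1]
    refine matrix_ext_of_orthogonal z (fun w => ?_) fun p hp => ?_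
    · rw [← mulVec_mulVec, ← mulVec_mulVec, hX]
      exact hX (⟨B, hB⟩ :: w)
    · rw [← mulVec_mulVec, ← mulVec_mulVec, hX0 p hp, mulVec_zero]
      -- The complement is invariant, because the span is invariant and the matrix of `B` is
      -- symmetric.
      refine hX0 _ fun w => ?_
      rw [← dotProduct_mulVec_of_symm (hsG _)]
      exact hp (⟨B, hB⟩ :: w)

end Word

/-! ### From the system `PW` to the system `L_iso` -/

theorem IsPartialIso.subset {V W : Type*} {G : SimpleGraph V} {H : SimpleGraph W}
    {p q : Finset (W × V)} (hq : IsPartialIso G H q) (hpq : p ⊆ q) : IsPartialIso G H p :=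
  fun a ha b hb => hq a (hpq ha) b (hpq hb)

theorem exists_perm_of_map_univ_eq {ι α : Type*} [Fintype ι] {f g : ι → α}
    (h : univ.val.map f = univ.val.map g) : ∃ σ : Equiv.Perm ι, g ∘ σ = f := by
  classical
  have hcard : ∀ a, Nonempty ({i // f i = a} ≃ {i // g i = a}) := by
    intro a
    rw [← Fintype.card_eq, Fintype.card_subtype, Fintype.card_subtype]
    have := congrArg (Multiset.count a) h
    rw [Multiset.count_map, Multiset.count_map] at this
    simpa only [eq_comm, Finset.card_def, Finset.filter_val] using this
  let σ : Equiv.Perm ι := (Equiv.sigmaFiberEquiv f).symm.trans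
    ((Equiv.sigmaCongrRight fun a => (hcard a).some).trans (Equiv.sigmaFiberEquiv g))
  refine ⟨σ, funext fun i => ?_⟩
  exact ((hcard (f i)).some ⟨i, rfl⟩).2

/-! ### Marginals of functions of multisets -/

section Multiset

variable {V W : Type*} [Fintype V]

/-- The function `N` of multisets, with `d` additional pairs with first entry `w₀` summed out. -/
def multisetMarginal (N : Multiset (W × V) → ℚ) (w₀ : W) : ℕ → Multiset (W × V) → ℚ
  | 0, s => N s
  | d + 1, s => ∑ v, multisetMarginal N w₀ d ((w₀, v) ::ₘ s)

theorem multisetMarginal_exchange [Fintype W] {N : Multiset (W × V) → ℚ} (w₀ : W) {n : ℕ}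
    (hN : ∀ s, s.card + 1 = n → ∀ w v, ∑ v', N ((w, v') ::ₘ s) = ∑ w', N ((w', v) ::ₘ s))
    (d : ℕ) (s : Multiset (W × V)) (hs : s.card + 1 + d = n) (w : W) (v : V) :
    ∑ v', multisetMarginal N w₀ d ((w, v') ::ₘ s) =
      ∑ w', multisetMarginal N w₀ d ((w', v) ::ₘ s) := by
  induction d generalizing s with
  | zero => exact hN s hs w v
  | succ d ih =>
    simp only [multisetMarginal]
    rw [Finset.sum_comm, Finset.sum_comm (s := (univ : Finset W))]
    refine Finset.sum_congr rfl fun v'' _ => ?_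
    simp only [Multiset.cons_swap (w₀, v'')]
    exact ih _ (by rw [Multiset.card_cons]; omega)

/-- Two exchanges through an auxiliary `v` replace `w` by `w₀`: the marginal does not depend on
which vertex is summed out. -/
theorem sum_multisetMarginal_left [Fintype W] {N : Multiset (W × V) → ℚ} (w₀ : W) {n : ℕ}
    (hN : ∀ s, s.card + 1 = n → ∀ w v, ∑ v', N ((w, v') ::ₘ s) = ∑ w', N ((w', v) ::ₘ s))
    (d : ℕ) (s : Multiset (W × V)) (hs : s.card + 1 + d = n) (w : W) :
    ∑ v', multisetMarginal N w₀ d ((w, v') ::ₘ s) = multisetMarginal N w₀ (d + 1) s := by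
  rcases isEmpty_or_nonempty V with hV | ⟨⟨v⟩⟩
  · simp [multisetMarginal]
  · rw [multisetMarginal_exchange w₀ hN d s hs w v, multisetMarginal,
      multisetMarginal_exchange w₀ hN d s hs w₀ v]

theorem multisetMarginal_eq_zero [DecidableEq V] [DecidableEq W] {G : SimpleGraph V}
    {H : SimpleGraph W} {N : Multiset (W × V) → ℚ} (w₀ : W) {n : ℕ}
    (hN : ∀ s, s.card = n → ¬ IsPartialIso G H s.toFinset → N s = 0)
    (d : ℕ) (s : Multiset (W × V)) (hs : s.card + d = n) (hp : ¬ IsPartialIso G H s.toFinset) :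
    multisetMarginal N w₀ d s = 0 := by
  induction d generalizing s with
  | zero => exact hN s hs hp
  | succ d ih =>
    refine Finset.sum_eq_zero fun v _ => ih _ (by rw [Multiset.card_cons]; omega) fun h => hp ?_
    exact h.subset (by simp)

theorem multisetMarginal_eq_sum (N : Multiset (W × V) → ℚ) (w₀ : W) (d : ℕ)
    (s : Multiset (W × V)) : multisetMarginal N w₀ d s =
      ∑ v : Fin d → V, N (univ.val.map (fun i => (w₀, v i)) + s) := by
  induction d generalizing s with
  | zero => simp [multisetMarginal]
  | succ d ih =>
    rw [multisetMarginal, ← (Fin.consEquiv fun _ : Fin (d + 1) => V).sum_comp,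
      Fintype.sum_prod_type]
    refine Finset.sum_congr rfl fun v _ => ?_
    rw [ih]
    refine Finset.sum_congr rfl fun v' _ => congrArg N ?_
    rw [Fin.univ_val_map, Fin.univ_val_map, List.ofFn_succ, ← Multiset.cons_coe,
      Multiset.cons_add, Multiset.add_cons]
    rfl

theorem exists_localSolution_of_multiset [Fintype W] [DecidableEq V] [DecidableEq W]
    {G : SimpleGraph V} {H : SimpleGraph W} {N : Multiset (W × V) → ℚ} (w₀ : W) {n : ℕ}
    (hex : ∀ s, s.card + 1 = n → ∀ w v, ∑ v', N ((w, v') ::ₘ s) = ∑ w', N ((w', v) ::ₘ s))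
    (hiso : ∀ s, s.card = n → ¬ IsPartialIso G H s.toFinset → N s = 0)
    (hone : ∑ v : Fin n → V, N (univ.val.map fun i => (w₀, v i)) = 1) :
    ∃ Y, LocalSolution n G H Y := by
  let Y : Finset (W × V) → ℚ := fun p => multisetMarginal N w₀ (n - p.card) p.val
  have hzero : ∀ p : Finset (W × V), p.card ≤ n → ¬ IsPartialIso G H p → Y p = 0 := by
    intro p hp hpi
    refine multisetMarginal_eq_zero w₀ hiso _ _ ?_ (by rwa [Finset.val_toFinset])
    rw [Finset.card_val]; omega
  have hins : ∀ (p : Finset (W × V)) a, a ∉ p → p.card < n →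
      Y (insert a p) = multisetMarginal N w₀ (n - p.card - 1) (a ::ₘ p.val) := by
    intro p a ha hp
    simp only [Y]
    rw [Finset.card_insert_of_notMem ha, Finset.insert_val_of_notMem ha, Nat.sub_sub]
  have hsucc : ∀ (p : Finset (W × V)), p.card < n →
      Y p = multisetMarginal N w₀ (n - p.card - 1 + 1) p.val := by
    intro p hp
    simp only [Y]
    rw [Nat.sub_add_cancel (by omega)]
  have hcard : ∀ (p : Finset (W × V)), p.card < n → p.val.card + 1 + (n - p.card - 1) = n := by
    intro p hp
    rw [Finset.card_val]; omega
  refine ⟨Y, fun p hp w => ?_, fun p hp v => ?_, ?_, hzero⟩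
  · have hle : ∀ v, (insert (w, v) p).card ≤ n := fun v => (card_insert_le _ _).trans hp
    -- If `w` already occurs in `p`, inserting its own pair changes nothing and every other pair
    -- breaks the partial isomorphism. Otherwise the insertion is a genuine multiset extension.
    by_cases h : ∃ v, (w, v) ∈ p
    · obtain ⟨v, hv⟩ := h
      rw [Finset.sum_eq_single v, Finset.insert_eq_of_mem hv]
      · intro v' _ hne
        refine hzero _ (hle v') fun hpi => hne ?_
        exact ((hpi (w, v') (mem_insert_self _ _) (w, v) (mem_insert_of_mem hv)).1).2 rfl
      · simp
    · push Not at h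
      rw [hsucc p hp, ← sum_multisetMarginal_left w₀ hex _ _ (hcard p hp) w]
      exact Finset.sum_congr rfl fun v _ => hins p _ (h v) hp
  · have hle : ∀ w, (insert (w, v) p).card ≤ n := fun v => (card_insert_le _ _).trans hp
    by_cases h : ∃ w, (w, v) ∈ p
    · obtain ⟨w, hw⟩ := h
      rw [Finset.sum_eq_single w, Finset.insert_eq_of_mem hw]
      · intro w' _ hne
        refine hzero _ (hle w') fun hpi => hne ?_
        exact ((hpi (w', v) (mem_insert_self _ _) (w, v) (mem_insert_of_mem hw)).1).1 rfl
      · simp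
    · push Not at h
      rw [hsucc p hp, multisetMarginal, multisetMarginal_exchange w₀ hex _ _ (hcard p hp) w₀ v]
      exact Finset.sum_congr rfl fun w _ => hins p _ (h w) hp
  · simp only [Y]
    rw [multisetMarginal_eq_sum, Finset.card_empty, Nat.sub_zero, ← hone]
    simp

end Multiset

/-! ### Symmetrisation over permutations of the entries -/

section Average

/-- The average of a function of tuples over all permutations of the entries. -/
noncomputable def permAverage {n : ℕ} {α : Type*} (x : (Fin n → α) → ℚ) (f : Fin n → α) : ℚ :=
  (n.factorial : ℚ)⁻¹ * ∑ σ : Equiv.Perm (Fin n), x (f ∘ σ)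

theorem permAverage_comp {n : ℕ} {α : Type*} (x : (Fin n → α) → ℚ) (f : Fin n → α)
    (σ : Equiv.Perm (Fin n)) : permAverage x (f ∘ σ) = permAverage x f := by
  unfold permAverage
  rw [← Equiv.sum_comp (Equiv.mulLeft σ) fun τ : Equiv.Perm (Fin n) => x (f ∘ τ)]
  rfl

open Classical in
/-- The function of multisets that corresponds to a symmetric function of `n`-tuples. -/
noncomputable def ofSymmetric {n : ℕ} {α : Type*} (x : (Fin n → α) → ℚ) (s : Multiset α) : ℚ :=
  if h : ∃ f : Fin n → α, univ.val.map f = s then x h.choose else 0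

theorem ofSymmetric_map {n : ℕ} {α : Type*} {x : (Fin n → α) → ℚ}
    (hx : ∀ f (σ : Equiv.Perm (Fin n)), x (f ∘ σ) = x f) (f : Fin n → α) :
    ofSymmetric x (univ.val.map f) = x f := by
  have h : ∃ g : Fin n → α, univ.val.map g = univ.val.map f := ⟨f, rfl⟩
  unfold ofSymmetric
  rw [dif_pos h]
  obtain ⟨σ, hσ⟩ := exists_perm_of_map_univ_eq h.choose_spec
  rw [← hσ, hx]

theorem exists_map_univ_eq {n : ℕ} {α : Type*} (s : Multiset α) (hs : s.card = n) :
    ∃ f : Fin n → α, univ.val.map f = s := by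
  subst hs
  obtain ⟨l, rfl⟩ := Quot.exists_rep s
  exact ⟨l.get, (Fin.univ_val_map l.get).trans (congrArg _ (List.ofFn_get l))⟩

variable {V W : Type*} [Fintype V] [Fintype W]

/-- Permuting the entries only moves the updated position, and the hypothesis covers all positions.
-/
theorem sum_permAverage_exchange {n : ℕ} {x : (Fin n → W × V) → ℚ}
    (hx : ∀ f j w v, ∑ v', x (Function.update f j (w, v')) = ∑ w', x (Function.update f j (w', v)))
    (f : Fin n → W × V) (j : Fin n) (w : W) (v : V) :
    ∑ v', permAverage x (Function.update f j (w, v')) =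
      ∑ w', permAverage x (Function.update f j (w', v)) := by
  unfold permAverage
  rw [← Finset.mul_sum, ← Finset.mul_sum, Finset.sum_comm, Finset.sum_comm (s := (univ : Finset W))]
  simp only [Function.update_comp_equiv]
  exact congrArg _ (Finset.sum_congr rfl fun σ _ => hx _ _ _ _)

end Average

/-! ### Consequences of commuting with the basal matrices -/

section Solution

variable {V W : Type*} [Fintype V] [Fintype W] {k : ℕ} {G : SimpleGraph V} {H : SimpleGraph W}
  {X : Matrix (Fin (k + 1) → W) (Fin (k + 1) → V) ℚ}

/-- Both matrices are diagonal, so the `(w, v)` entry of the commutation equation compares two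
diagonal 0-1 entries, each multiplied by `X w v`. -/
theorem IsSolutionPW.rel_iff (hX : IsSolutionPW k G H X)
    {B : BilabelledGraph (k + 1) (k + 1)} (hB : IsBasal k B) {L : Layer (k + 1)}
    (hG : B.IsGivenBy L G) (hH : B.IsGivenBy L H) (hL : ∀ i, L.keep i)
    {w : Fin (k + 1) → W} {v : Fin (k + 1) → V} (h0 : X w v ≠ 0) : L.Rel G v v ↔ L.Rel H w w := by
  classical
  have h := congrFun (congrFun (hX.2 B hB) w) v
  rw [hG.1, hH.1, Matrix.mul_apply, Matrix.mul_apply, Finset.sum_eq_single v,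
    Finset.sum_eq_single w, Layer.mat, Layer.mat, Matrix.of_apply, Matrix.of_apply] at h
  · split_ifs at h with h1 h2 h2
    · exact iff_of_true h1 h2
    · exact absurd h (by simp [h0])
    · exact absurd h (by simp [h0.symm])
    · exact iff_of_false h1 h2
  · intro w' _ hne
    rw [Layer.mat, Matrix.of_apply, if_neg, zero_mul]
    exact fun hr => hne (funext fun i => (hr.1 i (hL i)).symm)
  · simp
  · intro v' _ hne
    rw [Layer.mat, Matrix.of_apply, if_neg, mul_zero]
    exact fun hr => hne (funext fun i => hr.1 i (hL i))
  · simp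

theorem IsSolutionPW.eq_iff (hX : IsSolutionPW k G H X) {w : Fin (k + 1) → W}
    {v : Fin (k + 1) → V} (h0 : X w v ≠ 0) (i j : Fin (k + 1)) : v i = v j ↔ w i = w j := by
  rcases eq_or_ne i j with rfl | hij
  · simp
  · simpa [Layer.Rel] using hX.rel_iff (.identification i j hij)
      (identificationGraph_isGivenBy hij G) (identificationGraph_isGivenBy hij H)
      (fun _ => trivial) h0

theorem IsSolutionPW.adj_iff (hX : IsSolutionPW k G H X) {w : Fin (k + 1) → W}
    {v : Fin (k + 1) → V} (h0 : X w v ≠ 0) (i j : Fin (k + 1)) :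
    G.Adj (v i) (v j) ↔ H.Adj (w i) (w j) := by
  rcases eq_or_ne i j with rfl | hij
  · simp
  · simpa [Layer.Rel] using hX.rel_iff (.adjacency i j hij)
      (adjacencyGraph_isGivenBy hij G) (adjacencyGraph_isGivenBy hij H)
      (fun _ => trivial) h0

open Classical in
theorem sum_ite_agree_off {n : ℕ} (i : Fin n) (x : Fin n → V) (f : (Fin n → V) → ℚ) :
    ∑ y, (if ∀ a, a ≠ i → x a = y a then f y else 0) = ∑ v, f (Function.update x i v) := by
  rw [← Finset.sum_filter]
  refine Finset.sum_bij' (fun y _ => y i) (fun v _ => Function.update x i v) ?_ ?_ ?_ ?_ ?_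
  · simp
  · intro v _
    simp only [mem_filter, mem_univ, true_and]
    intro a ha
    simp [ha]
  · intro y hy
    simp only [mem_filter, mem_univ, true_and] at hy
    funext a
    by_cases ha : a = i
    · subst ha; simp
    · simpa [ha] using hy a ha
  · simp
  · intro y hy
    simp only [mem_filter, mem_univ, true_and] at hy
    congr 1
    funext a
    by_cases ha : a = i
    · subst ha; simp
    · simpa [ha] using (hy a ha).symm

theorem IsSolutionPW.sum_update (hX : IsSolutionPW k G H X) (w : Fin (k + 1) → W)
    (v : Fin (k + 1) → V) (i : Fin (k + 1)) :
    ∑ b, X w (Function.update v i b) = ∑ a, X (Function.update w i a) v := by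
  classical
  have h := congrFun (congrFun (hX.2 _ (.forgetting i)) w) v
  have hG := forgettingGraph_isGivenBy i G
  have hH := forgettingGraph_isGivenBy i H
  rw [hG.1, hH.1, ← Layer.mat_transpose hG.2, Matrix.mul_apply, Matrix.mul_apply] at h
  simp only [Layer.mat, Matrix.of_apply, Matrix.transpose_apply, Layer.Rel, mul_ite, mul_one,
    mul_zero, ite_mul, one_mul, zero_mul, false_implies, implies_true, and_true] at h
  rw [← sum_ite_agree_off i v (X w), ← sum_ite_agree_off i w fun w' => X w' v]
  exact h

theorem IsSolutionPW.exists_localSolution [DecidableEq V] [DecidableEq W]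
    (hX : IsSolutionPW k G H X) : ∃ Y, LocalSolution (k + 1) G H Y := by
  rcases isEmpty_or_nonempty W with hW | ⟨⟨w₀⟩⟩
  -- Without a vertex `w₀` the marginals are unavailable. A column sum over an empty index type
  -- cannot be 1, so `V` is empty too and the constant 1 solves the system.
  · have hV : IsEmpty V := by
      by_contra hV
      obtain ⟨v⟩ := not_isEmpty_iff.1 hV
      simpa using hX.1.2 fun _ => v
    exact ⟨fun _ => 1, fun _ _ w => isEmptyElim w, fun _ _ v => isEmptyElim v, rfl,
      fun p _ hp => (hp fun a => isEmptyElim a.1).elim⟩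
  let x : (Fin (k + 1) → W × V) → ℚ := fun f => X (fun i => (f i).1) fun i => (f i).2
  have hsymm := permAverage_comp x
  have hxe : ∀ f j w v, ∑ v', x (Function.update f j (w, v')) =
      ∑ w', x (Function.update f j (w', v)) := by
    intro f j w v
    have := hX.sum_update (Function.update (fun i => (f i).1) j w)
      (Function.update (fun i => (f i).2) j v) j
    simp only [Function.update_idem] at this
    have e1 : ∀ a b, (fun i => (Function.update f j (a, b) i).1) =
        Function.update (fun i => (f i).1) j a := fun a b => by
      funext i; by_cases h : i = j
      · subst h; simp
      · simp [h]
    have e2 : ∀ a b, (fun i => (Function.update f j (a, b) i).2) =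
        Function.update (fun i => (f i).2) j b := fun a b => by
      funext i; by_cases h : i = j
      · subst h; simp
      · simp [h]
    simpa only [x, e1, e2] using this
  refine exists_localSolution_of_multiset (N := ofSymmetric (permAverage x)) w₀ ?_ ?_ ?_
  · intro s hs w v
    obtain ⟨f, rfl⟩ := exists_map_univ_eq s (Nat.succ_injective hs)
    have hcons : ∀ a, ofSymmetric (permAverage x) (a ::ₘ univ.val.map f) =
        permAverage x (Function.update (Fin.cons (w, v) f : Fin (k + 1) → W × V) 0 a) := by
      intro a
      rw [Fin.update_cons_zero, ← ofSymmetric_map hsymm]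
      congr 1
      rw [Fin.univ_val_map, Fin.univ_val_map, List.ofFn_succ]
      rfl
    simp only [hcons]
    exact sum_permAverage_exchange hxe _ _ _ _
  · intro s hs hp
    obtain ⟨f, rfl⟩ := exists_map_univ_eq s hs
    rw [ofSymmetric_map hsymm, permAverage]
    refine mul_eq_zero_of_right _ (Finset.sum_eq_zero fun σ _ => ?_)
    by_contra h0
    refine hp fun a ha b hb => ?_
    obtain ⟨i, -, rfl⟩ := Multiset.mem_map.1 (Multiset.mem_toFinset.1 ha)
    obtain ⟨j, -, rfl⟩ := Multiset.mem_map.1 (Multiset.mem_toFinset.1 hb)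
    have h1 := hX.eq_iff h0 (σ.symm i) (σ.symm j)
    have h2 := hX.adj_iff h0 (σ.symm i) (σ.symm j)
    simp only [Function.comp_apply, Equiv.apply_symm_apply] at h1 h2
    exact ⟨h1, h2⟩
  · simp only [ofSymmetric_map hsymm, permAverage]
    rw [← Finset.mul_sum, Finset.sum_comm]
    have : ∀ σ : Equiv.Perm (Fin (k + 1)),
        ∑ v : Fin (k + 1) → V, x ((fun i => (w₀, v i)) ∘ σ) = 1 := by
      intro σ
      -- A constant tuple is fixed by `σ`, so the sum is a reordering of one row of `X`.
      rw [← hX.1.1 fun _ => w₀]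
      exact Equiv.sum_comp (Equiv.arrowCongr σ.symm (Equiv.refl V)) (X fun _ => w₀)
    rw [Finset.sum_congr rfl fun σ _ => this σ, Finset.sum_const, Finset.card_univ,
      Fintype.card_perm, Fintype.card_fin, nsmul_one]
    exact inv_mul_cancel₀ (Nat.cast_ne_zero.2 (Nat.factorial_ne_zero _))

end Solution

end HomTensor

theorem mainTheorem1 (k : ℕ) (hk : 1 ≤ k)
    {V W : Type*} [Fintype V] [Fintype W] [DecidableEq V] [DecidableEq W]
    (G : SimpleGraph V) (H : SimpleGraph W) :
    List.TFAE [
      HomTensor.HomIndistinguishable (HomTensor.PathwidthLE k) G H,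
      ∃ X : Matrix (Fin (k + 1) → W) (Fin (k + 1) → V) ℚ, HomTensor.IsSolutionPW k G H X,
      ∃ X : HomTensor.SmallSet W V (k + 1) → ℚ, HomTensor.IsSolutionLiso k G H X] := by
  tfae_have 1 → 2 := fun h => h.exists_isSolutionPW
  tfae_have 2 → 3 := fun ⟨_, hX⟩ =>
    HomTensor.exists_localSolution_iff.2 hX.exists_localSolution
  tfae_have 3 → 1 := fun h =>
    let ⟨_, hY⟩ := HomTensor.exists_localSolution_iff.1 h
    hY.homIndistinguishable
  tfae_finish
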